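/- Let $\Omega\subset\mathbb{C}$ be a simply connected domain (a non-empty, open, connected and simply connected set), fix $\zeta_0\in\Omega$, and let $H(\Omega)$ be the space of holomorphic functions on $\Omega$ with the topology of uniform convergence on compact subsets of $\Omega$. For $f\in H(\Omega)$ put $T^{(0)}(f)=f$ and, for $k\ge 1$ and $z\in\Omega$, $$T^{(k)}(f)(z)=\int_{\gamma_z}T^{(k-1)}(f)(\xi)\,d\xi ,$$ where $\gamma_z$ is any polygonal line in $\Omega$ from $\zeta_0$ to $z$. Such a line exists for every $z\in\Omega$, the integral does not depend on its choice, and $T^{(k)}(f)$ is holomorphic on $\Omega$ with derivative $T^{(k-1)}(f)$. For $k\in\mathbb{Z}$ let $f^{(k)}$ be the $k$-th derivative of $f$ if $k>0$, $f^{(0)}=f$, and $f^{(k)}=T^{(-k)}(f)$ if $k<0$. Then the set $$\mathcal{D}=\{f\in H(\Omega): f^{(k)}\text{ is unbounded on }\Omega\text{ for every }k\in\mathbb{Z}\}$$ is a dense $G_\delta$ subset of $H(\Omega)$. -/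

import Mathlib

open Set Topology

noncomputable section

/-- The extension by zero to `ℂ` of a function on `Ω`. On an open `Ω` only the values on `Ω` matter
for what follows. -/
def extendZero (Ω : Set ℂ) (f : Ω → ℂ) : ℂ → ℂ :=
  Function.extend Subtype.val f 0

/-- `H(Ω)`: the holomorphic functions on the open set `Ω`. As a subtype of `C(Ω, ℂ)` it carries the
compact-open topology, that is, the topology of uniform convergence on the compact subsets
of `Ω`. -/
def Hol (Ω : Set ℂ) : Set C(Ω, ℂ) :=
  {f | DifferentiableOn ℂ (extendZero Ω f) Ω}

/-- Polygonal lines: finite concatenations of line segments. -/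
inductive IsPolygonal : {a b : ℂ} → Path a b → Prop
  | segment (a b : ℂ) : IsPolygonal (Path.segment a b)
  | trans {a b c : ℂ} {γ₁ : Path a b} {γ₂ : Path b c} :
      IsPolygonal γ₁ → IsPolygonal γ₂ → IsPolygonal (γ₁.trans γ₂)

/-- `γ` is a polygonal line that stays in `Ω`. -/
def IsPolygonalIn (Ω : Set ℂ) {a b : ℂ} (γ : Path a b) : Prop :=
  IsPolygonal γ ∧ range γ ⊆ Ω

/-- The complex line integral `∫_γ f(ξ) dξ`. -/
def lineIntegral (f : ℂ → ℂ) {a b : ℂ} (γ : Path a b) : ℂ :=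
  curveIntegral (fun ξ => ContinuousLinearMap.toSpanSingleton ℂ (f ξ)) γ

open Classical in
/-- The antiderivative `T(f)(z) = ∫_{γ_z} f(ξ) dξ`, where `γ_z` is a polygonal line in `Ω` from `ζ₀`
to `z` (and `0` where there is none, in particular off `Ω`). -/
def antideriv (Ω : Set ℂ) (ζ₀ : ℂ) (f : ℂ → ℂ) (z : ℂ) : ℂ :=
  if h : ∃ γ : Path ζ₀ z, IsPolygonalIn Ω γ then lineIntegral f h.choose else 0

/-- The `k`-fold antiderivative `T^(k)(f)`, with `T^(0)(f) = f`. -/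
def iterAntideriv (Ω : Set ℂ) (ζ₀ : ℂ) (f : ℂ → ℂ) : ℕ → ℂ → ℂ
  | 0 => f
  | k + 1 => antideriv Ω ζ₀ (iterAntideriv Ω ζ₀ f k)

/-- `f^(k)` for `k ∈ ℤ`: the `k`-th derivative for `k ≥ 0`, the `|k|`-fold antiderivative for
`k < 0`. -/
def intDeriv (Ω : Set ℂ) (ζ₀ : ℂ) (f : ℂ → ℂ) : ℤ → ℂ → ℂ
  | Int.ofNat k => iteratedDeriv k f
  | Int.negSucc k => iterAntideriv Ω ζ₀ f (k + 1)

/-- The function `g` is unbounded on `Ω`. -/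
def UnboundedOn (g : ℂ → ℂ) (Ω : Set ℂ) : Prop :=
  ¬ ∃ M : ℝ, ∀ z ∈ Ω, ‖g z‖ ≤ M

/-- The set `𝒟` of all `f ∈ H(Ω)` such that `f^(k)` is unbounded on `Ω` for all `k ∈ ℤ`. -/
def unboundedSet (Ω : Set ℂ) (ζ₀ : ℂ) : Set (Hol Ω) :=
  {f | ∀ k : ℤ, UnboundedOn (intDeriv Ω ζ₀ (extendZero Ω f.1) k) Ω}

end

/-! Simple connectedness gives every holomorphic function on Ω a primitive, so polygonal integrals
do not depend on the path and `f^(k)` is linear in `f` for every integer `k`.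

The density statement is a Baire argument. For fixed `k`, each evaluation `f ↦ f^(k)(z)` is
continuous on H(Ω), so the `f` with `f^(k)` unbounded form a Gδ set. One such `g` makes this set
dense: if `f^(k)` is bounded, then `f + c • g` is in the set for every `c ≠ 0` and tends to `f` as
`c → 0`. H(Ω) is closed in the complete space C(Ω, ℂ), hence Baire, and the intersection over the
countably many `k` remains dense.

It remains to find one `g` for each `k`. If Ω ≠ ℂ, take a boundary point `w` and a derivative or
iterated antiderivative of `1/(z - w)`. If Ω = ℂ, take `exp` and apply Liouville's theorem. -/

/-! ### Primitives on simply connected open sets -/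

/-- On a simply connected space, local functions which differ by locally constant functions on
the overlaps glue, up to locally constant functions, to a global function. -/
theorem exists_glue_of_sub_locally_constant {X ι A : Type*} [TopologicalSpace X]
    [SimplyConnectedSpace X] [LocallyPathConnectedSpace X] [AddCommGroup A]
    (U : ι → Set X) (hU : ∀ i, IsOpen (U i)) (hcov : ∀ x, ∃ i, x ∈ U i) (g : ι → X → A)
    (hg : ∀ i j, ∀ x ∈ U i ∩ U j, ∀ᶠ y in 𝓝 x, g i y - g j y = g i x - g j x) :
    ∃ G : X → A, ∀ i, ∀ x ∈ U i, ∀ᶠ y in 𝓝 x, G y - g i y = G x - g i x := by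
  let _ : TopologicalSpace A := ⊥
  have : DiscreteTopology A := ⟨rfl⟩
  choose idx hidx using hcov
  -- With discrete fibre `A` and the locally constant differences as transition maps, this bundle is
  -- a covering of `X`; simple connectedness lifts the identity to a global section.
  let Z : FiberBundleCore ι X A :=
    { baseSet := U
      isOpen_baseSet := hU
      indexAt := idx
      mem_baseSet_at := hidx
      coordChange := fun i j x v => v + (g i x - g j x)
      coordChange_self := by intro i x _ v; simp
      continuousOn_coordChange := by
        rintro i j ⟨x, v⟩ ⟨hx, -⟩
        refine ContinuousAt.continuousWithinAt ?_
        have h1 : ∀ᶠ p : X × A in 𝓝 (x, v), g i p.1 - g j p.1 = g i x - g j x :=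
          (continuous_fst.tendsto (x, v)).eventually (hg i j x hx)
        have h2 : ∀ᶠ p : X × A in 𝓝 (x, v), p.2 = v := by
          have : ∀ᶠ w : A in 𝓝 v, w = v := by simp [nhds_discrete]
          exact (continuous_snd.tendsto (x, v)).eventually this
        refine (continuousAt_const (y := v + (g i x - g j x))).congr ?_
        filter_upwards [h1, h2] with p hp1 hp2
        rw [hp1, hp2]
      coordChange_comp := by intro i j k x _ v; abel }
  have hcovering : IsCoveringMap (Bundle.TotalSpace.proj : Z.TotalSpace → X) :=
    FiberBundle.isCoveringMap
  obtain ⟨x₀⟩ : Nonempty X := inferInstance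
  obtain ⟨F, ⟨-, hF⟩, -⟩ := hcovering.existsUnique_continuousMap_lifts (ContinuousMap.id X) x₀
    (⟨x₀, (0 : A)⟩ : Z.TotalSpace) rfl
  have hproj : ∀ x, (F x).proj = x := fun x => congrFun hF x
  let s : X → A := fun x => (F x).snd
  have hs : ∀ i, ∀ x, (Z.localTriv i (F x)).2 = s x + (g (idx x) x - g i x) := by
    intro i x
    rw [Z.localTriv_apply, hproj]
  -- With this choice, `G - g i` is the section read in chart `i`: continuous into a discrete space,
  -- hence locally constant.
  refine ⟨fun x => s x + g (idx x) x, fun i x hx => ?_⟩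
  have hc : ContinuousAt (fun y => (Z.localTriv i (F y)).2) x := by
    have h1 : ContinuousAt (Z.localTriv i) (F x) := by
      apply (Z.localTriv i).continuousAt
      rw [Bundle.Trivialization.mem_source]
      change (F x).proj ∈ U i
      rwa [hproj]
    exact continuousAt_snd.comp (h1.comp F.continuous.continuousAt)
  have hev : ∀ᶠ y in 𝓝 x, (Z.localTriv i (F y)).2 = (Z.localTriv i (F x)).2 := by
    have : ∀ᶠ w : A in 𝓝 ((Z.localTriv i (F x)).2), w = (Z.localTriv i (F x)).2 := by
      simp [nhds_discrete]
    exact hc.eventually this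
  filter_upwards [hev] with y hy
  rw [hs, hs] at hy
  rw [add_sub_assoc, add_sub_assoc, hy]

/-- A holomorphic function on a simply connected open set has a primitive. -/
theorem exists_hasDerivAt_of_isSimplyConnected {Ω : Set ℂ} (hΩ : IsOpen Ω)
    (hsc : IsSimplyConnected Ω) {f : ℂ → ℂ} (hf : DifferentiableOn ℂ f Ω) :
    ∃ F : ℂ → ℂ, ∀ z ∈ Ω, HasDerivAt F (f z) z := by
  have := hsc.simplyConnectedSpace
  have := hΩ.locallyPathConnectedSpace
  have hloc : ∀ x : Ω, ∃ r : ℝ, 0 < r ∧ Metric.ball (x : ℂ) r ⊆ Ω ∧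
      ∃ g : ℂ → ℂ, ∀ z ∈ Metric.ball (x : ℂ) r, HasDerivAt g (f z) z := by
    intro x
    obtain ⟨r, hr, hsub⟩ := Metric.isOpen_iff.1 hΩ x x.2
    exact ⟨r, hr, hsub, (hf.mono hsub).isExactOn_ball⟩
  choose r hr hsub g hg using hloc
  obtain ⟨G, hG⟩ := exists_glue_of_sub_locally_constant
    (fun i : Ω => (Subtype.val ⁻¹' Metric.ball (i : ℂ) (r i) : Set Ω))
    (fun i => Metric.isOpen_ball.preimage continuous_subtype_val)
    (fun x => ⟨x, Metric.mem_ball_self (hr x)⟩) (fun i z => g i z) (by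
      rintro i j x ⟨hi, hj⟩
      have hV : IsOpen (Metric.ball (i : ℂ) (r i) ∩ Metric.ball (j : ℂ) (r j)) :=
        Metric.isOpen_ball.inter Metric.isOpen_ball
      have hd : ∀ y ∈ Metric.ball (i : ℂ) (r i) ∩ Metric.ball (j : ℂ) (r j),
          HasDerivAt (fun z => g i z - g j z) 0 y := fun y hy => by
        simpa using (hg i y hy.1).fun_sub (hg j y hy.2)
      have hmem : ∀ᶠ y : Ω in 𝓝 x,
          (y : ℂ) ∈ Metric.ball (i : ℂ) (r i) ∩ Metric.ball (j : ℂ) (r j) :=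
        continuous_subtype_val.continuousAt.eventually (hV.mem_nhds ⟨hi, hj⟩)
      filter_upwards [hmem] with y hy
      exact hV.is_const_of_deriv_eq_zero
        ((convex_ball _ _).inter (convex_ball _ _)).isPreconnected
        (fun z hz => (hd z hz).differentiableAt.differentiableWithinAt)
        (fun z hz => (hd z hz).deriv) hy ⟨hi, hj⟩)
  refine ⟨Function.extend Subtype.val G 0, fun z hz => ?_⟩
  have h := hG ⟨z, hz⟩ ⟨z, hz⟩ (Metric.mem_ball_self (hr _))
  have h' : ∀ᶠ y in 𝓝 z, Function.extend Subtype.val G 0 y =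
      g ⟨z, hz⟩ y + (G ⟨z, hz⟩ - g ⟨z, hz⟩ z) := by
    rw [nhds_subtype_eq_comap, Filter.eventually_comap] at h
    filter_upwards [h, hΩ.mem_nhds hz] with y hy hyΩ
    have := hy ⟨y, hyΩ⟩ rfl
    rw [show y = ((⟨y, hyΩ⟩ : Ω) : ℂ) from rfl, Subtype.val_injective.extend_apply]
    linear_combination this
  exact ((hg ⟨z, hz⟩ z (Metric.mem_ball_self (hr _))).add_const _).congr_of_eventuallyEq h'

/-! ### Polygonal lines and path independence -/

/-- Any two points of a connected open set are joined in it by a polygonal line. -/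
theorem exists_isPolygonalIn {Ω : Set ℂ} (hΩ : IsOpen Ω) (hc : IsPreconnected Ω) {a b : ℂ}
    (ha : a ∈ Ω) (hb : b ∈ Ω) : ∃ γ : Path a b, IsPolygonalIn Ω γ := by
  refine hc.induction₂' (fun x y => ∃ γ : Path x y, IsPolygonalIn Ω γ) ?_ ?_ ha hb
  · intro x hx
    obtain ⟨r, hr, hsub⟩ := Metric.isOpen_iff.1 hΩ x hx
    filter_upwards [mem_nhdsWithin_of_mem_nhds (Metric.ball_mem_nhds x hr)] with y hy
    have hxr := Metric.mem_ball_self (x := x) hr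
    refine ⟨⟨Path.segment x y, .segment x y, ?_⟩, ⟨Path.segment y x, .segment y x, ?_⟩⟩ <;>
      rw [Path.range_segment]
    · exact ((convex_ball x r).segment_subset hxr hy).trans hsub
    · exact ((convex_ball x r).segment_subset hy hxr).trans hsub
  · rintro x y z - - - ⟨γ₁, h₁, h₁'⟩ ⟨γ₂, h₂, h₂'⟩
    exact ⟨γ₁.trans γ₂, h₁.trans h₂, by rw [Path.trans_range]; exact union_subset h₁' h₂'⟩

/-- Integrability is part of the induction because additivity of the integral under concatenation
requires it. -/
theorem curveIntegrable_and_lineIntegral_eq_sub {Ω : Set ℂ} {f F : ℂ → ℂ}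
    (hf : ContinuousOn f Ω) (hF : ∀ z ∈ Ω, HasDerivAt F (f z) z) {a b : ℂ} {γ : Path a b}
    (hγ : IsPolygonal γ) (hγΩ : range γ ⊆ Ω) :
    CurveIntegrable (fun ξ => ContinuousLinearMap.toSpanSingleton ℂ (f ξ)) γ ∧
      lineIntegral f γ = F b - F a := by
  induction hγ with
  | segment a b =>
    rw [Path.range_segment] at hγΩ
    have hmem : ∀ t ∈ uIcc (0 : ℝ) 1, AffineMap.lineMap a b t ∈ Ω := by
      intro t ht
      rw [uIcc_of_le zero_le_one] at ht
      exact hγΩ (segment_eq_image_lineMap ℝ a b ▸ mem_image_of_mem _ ht)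
    have hint : IntervalIntegrable (fun t : ℝ => ContinuousLinearMap.toSpanSingleton ℂ
        (f (AffineMap.lineMap a b t)) (b - a)) MeasureTheory.volume 0 1 := by
      apply ContinuousOn.intervalIntegrable
      simp only [ContinuousLinearMap.toSpanSingleton_apply]
      have hl : ContinuousOn (AffineMap.lineMap a b : ℝ → ℂ) (uIcc 0 1) :=
        AffineMap.lineMap_continuous.continuousOn
      exact (continuousOn_const (c := b - a)).smul (hf.comp hl hmem)
    refine ⟨curveIntegrable_segment.2 hint, ?_⟩
    rw [lineIntegral, curveIntegral_segment]
    have h := intervalIntegral.integral_eq_sub_of_hasDerivAt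
      (f := fun t : ℝ => F (AffineMap.lineMap a b t)) (fun t ht => ?_) hint
    · simpa using h
    · have := (hF _ (hmem t ht)).scomp t
        (AffineMap.hasDerivAt_lineMap (a := a) (b := b) (x := t))
      simpa [Function.comp_def] using this
  | trans h₁ h₂ ih₁ ih₂ =>
    rw [Path.trans_range, union_subset_iff] at hγΩ
    obtain ⟨i₁, e₁⟩ := ih₁ hγΩ.1
    obtain ⟨i₂, e₂⟩ := ih₂ hγΩ.2
    refine ⟨i₁.trans i₂, ?_⟩
    rw [lineIntegral] at e₁ e₂ ⊢
    rw [curveIntegral_trans i₁ i₂, e₁, e₂]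
    ring

theorem lineIntegral_eq_sub {Ω : Set ℂ} {f F : ℂ → ℂ}
    (hf : ContinuousOn f Ω) (hF : ∀ z ∈ Ω, HasDerivAt F (f z) z) {a b : ℂ} {γ : Path a b}
    (hγ : IsPolygonalIn Ω γ) : lineIntegral f γ = F b - F a :=
  (curveIntegrable_and_lineIntegral_eq_sub hf hF hγ.1 hγ.2).2

theorem antideriv_eq_sub {Ω : Set ℂ} (hΩ : IsOpen Ω) (hc : IsPreconnected Ω) {ζ₀ : ℂ}
    (hζ₀ : ζ₀ ∈ Ω) {f F : ℂ → ℂ} (hf : ContinuousOn f Ω)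
    (hF : ∀ z ∈ Ω, HasDerivAt F (f z) z) {z : ℂ} (hz : z ∈ Ω) :
    antideriv Ω ζ₀ f z = F z - F ζ₀ := by
  have h := exists_isPolygonalIn hΩ hc hζ₀ hz
  rw [antideriv, dif_pos h]
  exact lineIntegral_eq_sub hf hF h.choose_spec

section

open Filter

variable {Ω : Set ℂ} {ζ₀ : ℂ}

/-! ### Algebra of iterated derivatives and antiderivatives -/

theorem hasDerivAt_antideriv (hΩ : IsOpen Ω) (hsc : IsSimplyConnected Ω) (hζ₀ : ζ₀ ∈ Ω)
    {f : ℂ → ℂ} (hf : DifferentiableOn ℂ f Ω) {z : ℂ} (hz : z ∈ Ω) :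
    HasDerivAt (antideriv Ω ζ₀ f) (f z) z := by
  obtain ⟨F, hF⟩ := exists_hasDerivAt_of_isSimplyConnected hΩ hsc hf
  refine ((hF z hz).sub_const (F ζ₀)).congr_of_eventuallyEq ?_
  filter_upwards [hΩ.mem_nhds hz] with y hy
  exact antideriv_eq_sub hΩ hsc.isPathConnected.isConnected.isPreconnected hζ₀ hf.continuousOn
    hF hy

theorem differentiableOn_iterAntideriv (hΩ : IsOpen Ω) (hsc : IsSimplyConnected Ω)
    (hζ₀ : ζ₀ ∈ Ω) {f : ℂ → ℂ} (hf : DifferentiableOn ℂ f Ω) (k : ℕ) :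
    DifferentiableOn ℂ (iterAntideriv Ω ζ₀ f k) Ω := by
  induction k with
  | zero => exact hf
  | succ k ih =>
    exact fun z hz =>
      (hasDerivAt_antideriv hΩ hsc hζ₀ ih hz).differentiableAt.differentiableWithinAt

theorem hasDerivAt_iterAntideriv (hΩ : IsOpen Ω) (hsc : IsSimplyConnected Ω) (hζ₀ : ζ₀ ∈ Ω)
    {f : ℂ → ℂ} (hf : DifferentiableOn ℂ f Ω) (k : ℕ) {z : ℂ} (hz : z ∈ Ω) :
    HasDerivAt (iterAntideriv Ω ζ₀ f (k + 1)) (iterAntideriv Ω ζ₀ f k z) z :=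
  hasDerivAt_antideriv hΩ hsc hζ₀ (differentiableOn_iterAntideriv hΩ hsc hζ₀ hf k) hz

theorem antideriv_self (hΩ : IsOpen Ω) (hsc : IsSimplyConnected Ω) (hζ₀ : ζ₀ ∈ Ω)
    {f : ℂ → ℂ} (hf : DifferentiableOn ℂ f Ω) : antideriv Ω ζ₀ f ζ₀ = 0 := by
  obtain ⟨F, hF⟩ := exists_hasDerivAt_of_isSimplyConnected hΩ hsc hf
  rw [antideriv_eq_sub hΩ hsc.isPathConnected.isConnected.isPreconnected hζ₀ hf.continuousOn
    hF hζ₀, sub_self]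

theorem iterAntideriv_succ_eq_lineIntegral (hΩ : IsOpen Ω) (hsc : IsSimplyConnected Ω)
    (hζ₀ : ζ₀ ∈ Ω) {f : ℂ → ℂ} (hf : DifferentiableOn ℂ f Ω) (k : ℕ) {z : ℂ}
    {γ : Path ζ₀ z} (hγ : IsPolygonalIn Ω γ) :
    iterAntideriv Ω ζ₀ f (k + 1) z = lineIntegral (iterAntideriv Ω ζ₀ f k) γ := by
  have hk := differentiableOn_iterAntideriv hΩ hsc hζ₀ hf k
  rw [lineIntegral_eq_sub hk.continuousOn (fun w hw => hasDerivAt_antideriv hΩ hsc hζ₀ hk hw) hγ,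
    antideriv_self hΩ hsc hζ₀ hk, sub_zero]
  rfl

theorem differentiableOn_iteratedDeriv (hΩ : IsOpen Ω) {f : ℂ → ℂ}
    (hf : DifferentiableOn ℂ f Ω) (k : ℕ) : DifferentiableOn ℂ (iteratedDeriv k f) Ω := by
  induction k with
  | zero => simpa using hf
  | succ k ih =>
    rw [iteratedDeriv_succ]
    exact ih.deriv hΩ

theorem iteratedDeriv_iterAntideriv (hΩ : IsOpen Ω) (hsc : IsSimplyConnected Ω) (hζ₀ : ζ₀ ∈ Ω)
    {f : ℂ → ℂ} (hf : DifferentiableOn ℂ f Ω) (k : ℕ) :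
    EqOn (iteratedDeriv k (iterAntideriv Ω ζ₀ f k)) f Ω := by
  induction k with
  | zero => intro z _; simp [iterAntideriv]
  | succ k ih =>
    intro z hz
    rw [iteratedDeriv_succ']
    have h : EqOn (deriv (iterAntideriv Ω ζ₀ f (k + 1))) (iterAntideriv Ω ζ₀ f k) Ω :=
      fun w hw => (hasDerivAt_iterAntideriv hΩ hsc hζ₀ hf k hw).deriv
    rw [h.iteratedDeriv_of_isOpen hΩ k hz, ih hz]

/-- Each integration adds only a constant to `F` and integrates the earlier error again. That the
error is entire suffices later: it stays bounded near any boundary point of Ω. -/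
theorem iterAntideriv_iteratedDeriv (hΩ : IsOpen Ω) (hc : IsPreconnected Ω) (hζ₀ : ζ₀ ∈ Ω)
    (k : ℕ) {f F : ℂ → ℂ} (hF : DifferentiableOn ℂ F Ω) (hf : EqOn f (iteratedDeriv k F) Ω) :
    ∃ e : ℂ → ℂ, Differentiable ℂ e ∧ EqOn (iterAntideriv Ω ζ₀ f k) (F + e) Ω := by
  induction k generalizing F with
  | zero => exact ⟨0, differentiable_const 0, fun z hz => by simpa [iterAntideriv] using hf hz⟩
  | succ k ih =>
    obtain ⟨e, he, h⟩ := ih (hF.deriv hΩ) (by rwa [iteratedDeriv_succ'] at hf)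
    obtain ⟨E, hE⟩ := he.isExactOn_univ
    refine ⟨fun z => E z - (F ζ₀ + E ζ₀),
      fun z => ((hE z (mem_univ z)).sub_const _).differentiableAt, fun z hz => ?_⟩
    have hcont : ContinuousOn (iterAntideriv Ω ζ₀ f k) Ω :=
      ((hF.deriv hΩ).continuousOn.add he.continuous.continuousOn).congr h
    rw [iterAntideriv, antideriv_eq_sub hΩ hc hζ₀ (F := F + E) hcont (fun w hw => ?_) hz]
    · simp only [Pi.add_apply]
      ring
    · rw [h hw]
      exact (hF.differentiableAt (hΩ.mem_nhds hw)).hasDerivAt.add (hE w (mem_univ w))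

/-- Linearity of `f ↦ f^(k)`. -/
theorem intDeriv_add_const_smul (hΩ : IsOpen Ω) (hsc : IsSimplyConnected Ω) (hζ₀ : ζ₀ ∈ Ω)
    {f g : ℂ → ℂ} (hf : DifferentiableOn ℂ f Ω) (hg : DifferentiableOn ℂ g Ω) (c : ℂ) (k : ℤ) :
    EqOn (intDeriv Ω ζ₀ (f + c • g) k) (intDeriv Ω ζ₀ f k + c • intDeriv Ω ζ₀ g k) Ω := by
  have hanti : ∀ n, EqOn (iterAntideriv Ω ζ₀ (f + c • g) n)
      (iterAntideriv Ω ζ₀ f n + c • iterAntideriv Ω ζ₀ g n) Ω := by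
    intro n
    induction n with
    | zero => intro z _; rfl
    | succ n ih =>
      intro z hz
      have hfn := differentiableOn_iterAntideriv hΩ hsc hζ₀ hf n
      have hgn := differentiableOn_iterAntideriv hΩ hsc hζ₀ hg n
      rw [iterAntideriv, antideriv_eq_sub hΩ hsc.isPathConnected.isConnected.isPreconnected hζ₀
        (F := iterAntideriv Ω ζ₀ f (n + 1) + c • iterAntideriv Ω ζ₀ g (n + 1))
        ((hfn.add (hgn.const_smul c)).continuousOn.congr ih) (fun w hw => ?_) hz]
      · simp [iterAntideriv, antideriv_self hΩ hsc hζ₀ hfn, antideriv_self hΩ hsc hζ₀ hgn]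
      · rw [ih hw]
        exact (hasDerivAt_iterAntideriv hΩ hsc hζ₀ hf n hw).add
          ((hasDerivAt_iterAntideriv hΩ hsc hζ₀ hg n hw).const_smul c)
  intro z hz
  cases k with
  | ofNat n =>
    have hf' : ContDiffAt ℂ n f z := (hf.analyticAt (hΩ.mem_nhds hz)).contDiffAt
    have hg' : ContDiffAt ℂ n g z := (hg.analyticAt (hΩ.mem_nhds hz)).contDiffAt
    simp only [intDeriv, Pi.add_apply, Pi.smul_apply]
    have hcg : ContDiffAt ℂ n (c • g) z := contDiffAt_const.smul hg'
    rw [iteratedDeriv_add hf' hcg, iteratedDeriv_const_smul hg']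
  | negSucc n => exact hanti (n + 1) hz

/-! ### Convergence of primitives -/

theorem tendstoUniformlyOn_ball_of_hasDerivAt {ι : Type*} {l : Filter ι}
    {F f : ι → ℂ → ℂ} {G g : ℂ → ℂ} {c : ℂ} {r : ℝ}
    (hF : ∀ i, ∀ z ∈ Metric.ball c r, HasDerivAt (F i) (f i z) z)
    (hG : ∀ z ∈ Metric.ball c r, HasDerivAt G (g z) z)
    (hfg : TendstoUniformlyOn f g l (Metric.ball c r)) {x : ℂ} (hx : x ∈ Metric.ball c r)
    (hFx : Tendsto (fun i => F i x) l (𝓝 (G x))) :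
    TendstoUniformlyOn F G l (Metric.ball c r) := by
  have hr : 0 < r := Metric.pos_of_mem_ball hx
  rw [Metric.tendstoUniformlyOn_iff] at hfg ⊢
  intro ε hε
  -- Points of the ball are less than `2 * r` apart, so the mean value inequality costs at most `ε /
  -- 2`; the error at `x` is the other half.
  filter_upwards [hfg (ε / (4 * r)) (by positivity),
    Metric.tendsto_nhds.1 hFx (ε / 2) (by positivity)] with i hi hix y hy
  have h := Convex.norm_image_sub_le_of_norm_hasDerivWithin_le
    (fun z hz => ((hG z hz).sub (hF i z hz)).hasDerivWithinAt) (C := ε / (4 * r))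
    (fun z hz => by rw [← dist_eq_norm]; exact (hi z hz).le) (convex_ball c r) hx hy
  have hxy : ‖y - x‖ < 2 * r := by
    rw [← dist_eq_norm]
    have := dist_triangle_right y x c
    have h1 := Metric.mem_ball.1 hx
    have h2 := Metric.mem_ball.1 hy
    linarith
  have h3 : ε / (4 * r) * ‖y - x‖ ≤ ε / 2 := by
    calc ε / (4 * r) * ‖y - x‖ ≤ ε / (4 * r) * (2 * r) := by gcongr
      _ = ε / 2 := by field_simp; norm_num
  rw [dist_comm, dist_eq_norm] at hix
  simp only [Pi.sub_apply] at h
  rw [dist_eq_norm]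
  calc ‖G y - F i y‖ = ‖(G y - F i y - (G x - F i x)) + (G x - F i x)‖ := by congr 1; ring
    _ ≤ ‖G y - F i y - (G x - F i x)‖ + ‖G x - F i x‖ := norm_add_le _ _
    _ < ε := by linarith

/-- Locally uniform convergence of the derivatives and convergence at one point imply locally
uniform convergence. -/
theorem tendstoLocallyUniformlyOn_of_hasDerivAt (hΩ : IsOpen Ω) (hc : IsPreconnected Ω)
    {ι : Type*} {l : Filter ι} {F f : ι → ℂ → ℂ} {G g : ℂ → ℂ}
    (hF : ∀ i, ∀ z ∈ Ω, HasDerivAt (F i) (f i z) z) (hG : ∀ z ∈ Ω, HasDerivAt G (g z) z)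
    (hfg : TendstoLocallyUniformlyOn f g l Ω) {x : ℂ} (hx : x ∈ Ω)
    (hFx : Tendsto (fun i => F i x) l (𝓝 (G x))) :
    TendstoLocallyUniformlyOn F G l Ω := by
  have hball : ∀ z ∈ Ω, ∃ r > 0, ∀ w ∈ Metric.ball z r,
      Tendsto (fun i => F i w) l (𝓝 (G w)) → TendstoUniformlyOn F G l (Metric.ball z r) := by
    intro z hz
    have hn : ∃ v ∈ 𝓝 z, v ⊆ Ω ∧ TendstoUniformlyOn f g l v := by
      have hiff : TendstoLocallyUniformlyOn f g l Ω ↔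
          ∀ x ∈ Ω, ∃ v ∈ 𝓝[Ω] x, TendstoUniformlyOn f g l v :=
        (tendstoLocallyUniformlyOn_TFAE f g l hΩ).out 0 2
      obtain ⟨v, hv, huv⟩ := hiff.1 hfg z hz
      rw [hΩ.nhdsWithin_eq hz] at hv
      exact ⟨v ∩ Ω, inter_mem hv (hΩ.mem_nhds hz), inter_subset_right,
        huv.mono inter_subset_left⟩
    obtain ⟨v, hv, hvΩ, huv⟩ := hn
    obtain ⟨r, hr, hrv⟩ := Metric.mem_nhds_iff.1 hv
    exact ⟨r, hr, fun w hw hFw => tendstoUniformlyOn_ball_of_hasDerivAt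
      (fun i y hy => hF i y (hvΩ (hrv hy))) (fun y hy => hG y (hvΩ (hrv hy)))
      (huv.mono hrv) hw hFw⟩
  -- Convergence at one point of a small ball gives it on the whole ball, so it spreads over the
  -- connected set Ω.
  have hpt : ∀ z ∈ Ω, Tendsto (fun i => F i z) l (𝓝 (G z)) := by
    intro z hz
    refine hc.induction₂' (fun a b => Tendsto (fun i => F i a) l (𝓝 (G a)) →
      Tendsto (fun i => F i b) l (𝓝 (G b))) ?_ (fun _ _ _ _ _ _ h₁ h₂ => h₂ ∘ h₁) hx hz hFx
    intro a ha
    obtain ⟨r, hr, h⟩ := hball a ha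
    filter_upwards [mem_nhdsWithin_of_mem_nhds (Metric.ball_mem_nhds a hr)] with b hb
    have ha' := Metric.mem_ball_self (x := a) hr
    exact ⟨fun h' => (h a ha' h').tendsto_at hb, fun h' => (h b hb h').tendsto_at ha'⟩
  intro u hu z hz
  obtain ⟨r, hr, h⟩ := hball z hz
  exact ⟨Metric.ball z r, mem_nhdsWithin_of_mem_nhds (Metric.ball_mem_nhds z hr),
    h z (Metric.mem_ball_self hr) (hpt z hz) u hu⟩

/-! ### H(Ω) as a Baire space -/

theorem extendZero_coe (f : Ω → ℂ) (z : Ω) : extendZero Ω f z = f z :=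
  Subtype.val_injective.extend_apply f 0 z

theorem extendZero_add_const_smul (f g : Ω → ℂ) (c : ℂ) :
    extendZero Ω (f + c • g) = extendZero Ω f + c • extendZero Ω g := by
  funext z
  by_cases hz : z ∈ Ω
  · have h := fun k : Ω → ℂ => extendZero_coe k ⟨z, hz⟩
    simp only [Pi.add_apply, Pi.smul_apply] at h ⊢
    rw [h, h, h, Pi.add_apply, Pi.smul_apply]
  · have h : ∀ k : Ω → ℂ, extendZero Ω k z = 0 := fun k =>
      Function.extend_apply' k (0 : ℂ → ℂ) z fun ⟨a, ha⟩ => hz (ha ▸ a.2)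
    simp [h]

theorem exists_hol_eqOn {F : ℂ → ℂ} (hF : DifferentiableOn ℂ F Ω) :
    ∃ f : Hol Ω, EqOn (extendZero Ω f.1) F Ω := by
  have h : EqOn (extendZero Ω (Ω.domRestrict F)) F Ω :=
    fun z hz => extendZero_coe (Ω.domRestrict F) ⟨z, hz⟩
  exact ⟨⟨⟨Ω.domRestrict F, hF.continuousOn.domRestrict⟩, hF.congr h⟩, h⟩

theorem tendstoLocallyUniformlyOn_extendZero (hΩ : IsOpen Ω) {l : Filter C(Ω, ℂ)}
    {f : C(Ω, ℂ)} (hl : l ≤ 𝓝 f) :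
    TendstoLocallyUniformlyOn (fun p : C(Ω, ℂ) => extendZero Ω p) (extendZero Ω f) l Ω := by
  have := hΩ.locallyCompactSpace
  rw [tendstoLocallyUniformlyOn_iff_tendstoLocallyUniformly_comp_coe]
  have h := ContinuousMap.tendsto_iff_tendstoLocallyUniformly.1 (tendsto_id.mono_left hl :
    Tendsto (fun p : C(Ω, ℂ) => p) l (𝓝 f))
  simpa only [extendZero_coe, Function.comp_def, id] using h

/-- Weierstrass: locally uniform limits of holomorphic functions are holomorphic. -/
theorem isClosed_hol (hΩ : IsOpen Ω) : IsClosed (Hol Ω) := by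
  rw [isClosed_iff_forall_filter]
  intro f l _ hl hf
  exact (tendstoLocallyUniformlyOn_extendZero hΩ hf).differentiableOn (hl (mem_principal_self _)) hΩ

theorem baireSpace_hol (hΩ : IsOpen Ω) : BaireSpace (Hol Ω) := by
  have := hΩ.locallyCompactSpace
  have := (isClosed_hol hΩ).completeSpace_coe
  infer_instance

/-! ### Continuity of `f ↦ f^(k)` -/

theorem differentiableOn_intDeriv (hΩ : IsOpen Ω) (hsc : IsSimplyConnected Ω) (hζ₀ : ζ₀ ∈ Ω)
    {f : ℂ → ℂ} (hf : DifferentiableOn ℂ f Ω) (k : ℤ) :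
    DifferentiableOn ℂ (intDeriv Ω ζ₀ f k) Ω := by
  cases k with
  | ofNat n => exact differentiableOn_iteratedDeriv hΩ hf n
  | negSucc n => exact differentiableOn_iterAntideriv hΩ hsc hζ₀ hf (n + 1)

/-- The map `f ↦ f^(k)` is continuous for locally uniform convergence. -/
theorem tendstoLocallyUniformlyOn_intDeriv (hΩ : IsOpen Ω) (hsc : IsSimplyConnected Ω)
    (hζ₀ : ζ₀ ∈ Ω) {ι : Type*} {l : Filter ι} {f : ι → ℂ → ℂ} {g : ℂ → ℂ}
    (hf : ∀ i, DifferentiableOn ℂ (f i) Ω) (hg : DifferentiableOn ℂ g Ω)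
    (hfg : TendstoLocallyUniformlyOn f g l Ω) (k : ℤ) :
    TendstoLocallyUniformlyOn (fun i => intDeriv Ω ζ₀ (f i) k) (intDeriv Ω ζ₀ g k) l Ω := by
  have hpos : ∀ n : ℕ, TendstoLocallyUniformlyOn (fun i => iteratedDeriv n (f i))
      (iteratedDeriv n g) l Ω := by
    intro n
    induction n with
    | zero => simpa using hfg
    | succ n ih =>
      simp only [iteratedDeriv_succ]
      exact ih.deriv (Eventually.of_forall fun i => differentiableOn_iteratedDeriv hΩ (hf i) n) hΩ
  have hneg : ∀ n : ℕ, TendstoLocallyUniformlyOn (fun i => iterAntideriv Ω ζ₀ (f i) n)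
      (iterAntideriv Ω ζ₀ g n) l Ω := by
    intro n
    induction n with
    | zero => exact hfg
    | succ n ih =>
      refine tendstoLocallyUniformlyOn_of_hasDerivAt hΩ
        hsc.isPathConnected.isConnected.isPreconnected
        (fun i z hz => hasDerivAt_iterAntideriv hΩ hsc hζ₀ (hf i) n hz)
        (fun z hz => hasDerivAt_iterAntideriv hΩ hsc hζ₀ hg n hz) ih hζ₀ ?_
      -- All antiderivatives vanish at `ζ₀`, which supplies the one point of convergence.
      simp only [iterAntideriv, antideriv_self hΩ hsc hζ₀ (differentiableOn_iterAntideriv hΩ hsc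
        hζ₀ hg n), antideriv_self hΩ hsc hζ₀ (differentiableOn_iterAntideriv hΩ hsc hζ₀ (hf _) n)]
      exact tendsto_const_nhds
  cases k with
  | ofNat n => exact hpos n
  | negSucc n => exact hneg (n + 1)

theorem continuous_intDeriv_apply (hΩ : IsOpen Ω) (hsc : IsSimplyConnected Ω) (hζ₀ : ζ₀ ∈ Ω)
    (k : ℤ) {z : ℂ} (hz : z ∈ Ω) :
    Continuous fun f : Hol Ω => intDeriv Ω ζ₀ (extendZero Ω f.1) k z := by
  rw [continuous_iff_continuousAt]
  intro f
  have h : TendstoLocallyUniformlyOn (fun p : Hol Ω => extendZero Ω p.1) (extendZero Ω f.1)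
      (𝓝 f) Ω := fun u hu x hx => by
    obtain ⟨t, ht, h⟩ := tendstoLocallyUniformlyOn_extendZero hΩ le_rfl u hu x hx
    exact ⟨t, ht, continuous_subtype_val.continuousAt.eventually h⟩
  exact (tendstoLocallyUniformlyOn_intDeriv hΩ hsc hζ₀ (fun p => p.2) f.2 h k).tendsto_at hz

/-! ### Gδ and density for a single `k` -/

/-- The functions `f ∈ H(Ω)` for which `f^(k)` is unbounded. -/
def unboundedAt (Ω : Set ℂ) (ζ₀ : ℂ) (k : ℤ) : Set (Hol Ω) :=
  {f | UnboundedOn (intDeriv Ω ζ₀ (extendZero Ω f.1) k) Ω}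

theorem isGδ_unboundedAt (hΩ : IsOpen Ω) (hsc : IsSimplyConnected Ω) (hζ₀ : ζ₀ ∈ Ω) (k : ℤ) :
    IsGδ (unboundedAt Ω ζ₀ k) := by
  have h : unboundedAt Ω ζ₀ k = ⋂ n : ℕ, ⋃ z ∈ Ω,
      {f : Hol Ω | (n : ℝ) < ‖intDeriv Ω ζ₀ (extendZero Ω f.1) k z‖} := by
    ext f
    simp only [unboundedAt, UnboundedOn, mem_ofPred_eq, mem_iInter, mem_iUnion, exists_prop]
    push Not
    refine ⟨fun h n => h n, fun h M => ?_⟩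
    obtain ⟨n, hn⟩ := exists_nat_gt M
    obtain ⟨z, hz, hz'⟩ := h n
    exact ⟨z, hz, hn.trans hz'⟩
  rw [h]
  refine IsGδ.iInter_of_isOpen fun n => isOpen_biUnion fun z hz => ?_
  exact isOpen_lt continuous_const (continuous_intDeriv_apply hΩ hsc hζ₀ k hz).norm

theorem dense_unboundedAt_of_nonempty (hΩ : IsOpen Ω) (hsc : IsSimplyConnected Ω)
    (hζ₀ : ζ₀ ∈ Ω) (k : ℤ) (hne : (unboundedAt Ω ζ₀ k).Nonempty) :
    Dense (unboundedAt Ω ζ₀ k) := by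
  obtain ⟨g, hg⟩ := hne
  intro f
  by_cases hf : f ∈ unboundedAt Ω ζ₀ k
  · exact subset_closure hf
  obtain ⟨M, hM⟩ : ∃ M : ℝ, ∀ z ∈ Ω, ‖intDeriv Ω ζ₀ (extendZero Ω f.1) k z‖ ≤ M := not_not.1 hf
  have hext : ∀ c : ℂ, extendZero Ω (f.1 + c • g.1 : C(Ω, ℂ)) =
      extendZero Ω f.1 + c • extendZero Ω g.1 := fun c => extendZero_add_const_smul f.1 g.1 c
  let p : ℂ → Hol Ω := fun c => ⟨f.1 + c • g.1, by
    change DifferentiableOn ℂ _ Ω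
    rw [hext]
    exact f.2.add (g.2.const_smul c)⟩
  have hp : Continuous p := by
    refine Continuous.subtype_mk ?_ _
    fun_prop
  -- The value `c = 0` is excluded because a bound on `(f + c • g)^(k)` is turned into one on
  -- `g^(k)` by dividing by `‖c‖`.
  have hp0 : Tendsto p (𝓝[≠] 0) (𝓝 f) := by
    have h := hp.tendsto 0
    rw [show p 0 = f from Subtype.ext (by ext; simp [p])] at h
    exact h.mono_left nhdsWithin_le_nhds
  refine mem_closure_of_tendsto hp0 (eventually_mem_nhdsWithin.mono fun c hc => ?_)
  rintro ⟨N, hN⟩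
  have hc0 : 0 < ‖c‖ := norm_pos_iff.2 hc
  refine hg ⟨(N + M) / ‖c‖, fun z hz => ?_⟩
  have h1 := hN z hz
  have h2 := hM z hz
  change ‖intDeriv Ω ζ₀ (extendZero Ω (f.1 + c • g.1 : C(Ω, ℂ))) k z‖ ≤ N at h1
  rw [hext, intDeriv_add_const_smul hΩ hsc hζ₀ f.2 g.2 c k hz, Pi.add_apply, Pi.smul_apply] at h1
  rw [le_div_iff₀ hc0, mul_comm, ← norm_smul]
  calc ‖c • intDeriv Ω ζ₀ (extendZero Ω g.1) k z‖
      = ‖(intDeriv Ω ζ₀ (extendZero Ω f.1) k z + c • intDeriv Ω ζ₀ (extendZero Ω g.1) k z)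
          - intDeriv Ω ζ₀ (extendZero Ω f.1) k z‖ := by rw [add_sub_cancel_left]
    _ ≤ _ := norm_sub_le _ _
    _ ≤ N + M := add_le_add h1 h2

/-! ### Existence of a function with unbounded `f^(k)` -/

theorem unboundedOn_inv_sub_add {w : ℂ} (hw : w ∈ closure Ω) (hwΩ : w ∉ Ω) {e : ℂ → ℂ}
    (he : ContinuousAt e w) : UnboundedOn ((fun z => (z - w)⁻¹) + e) Ω := by
  rintro ⟨M, hM⟩
  have hne : (𝓝[Ω] w).NeBot := mem_closure_iff_nhdsWithin_neBot.1 hw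
  have hle : 𝓝[Ω] w ≤ 𝓝[≠] w :=
    nhdsWithin_mono w fun z hz hzw => hwΩ (hzw ▸ hz)
  have h1 : Tendsto (fun z : ℂ => ‖(z - w)⁻¹‖) (𝓝[Ω] w) atTop := by
    have h0 : Tendsto (fun z : ℂ => z - w) (𝓝[≠] w) (𝓝[≠] 0) := by
      refine tendsto_nhdsWithin_iff.2 ⟨?_, eventually_mem_nhdsWithin.mono fun z hz =>
        sub_ne_zero.2 hz⟩
      have : Tendsto (fun z : ℂ => z - w) (𝓝 w) (𝓝 (w - w)) :=
        (continuous_id.sub continuous_const).tendsto w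
      rw [sub_self] at this
      exact this.mono_left nhdsWithin_le_nhds
    exact ((tendsto_norm_inv_nhdsNE_zero_atTop).comp h0).mono_left hle
  have h2 : ∀ᶠ z in 𝓝[Ω] w, ‖e z‖ < ‖e w‖ + 1 :=
    nhdsWithin_le_nhds (he.norm.eventually (gt_mem_nhds (lt_add_one _)))
  obtain ⟨z, ⟨hz1, hz2⟩, hz3⟩ := ((h1.eventually_gt_atTop (M + (‖e w‖ + 1))).and h2).and
    self_mem_nhdsWithin |>.exists
  have h3 := hM z hz3
  have h4 : ‖(z - w)⁻¹‖ ≤ ‖(z - w)⁻¹ + e z‖ + ‖e z‖ := by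
    simpa using norm_sub_le ((z - w)⁻¹ + e z) (e z)
  simp only [Pi.add_apply] at h3
  linarith

theorem UnboundedOn.congr {f g : ℂ → ℂ} (hf : UnboundedOn f Ω) (h : EqOn g f Ω) :
    UnboundedOn g Ω := by
  rintro ⟨M, hM⟩
  exact hf ⟨M, fun z hz => h hz ▸ hM z hz⟩

/-- The witness is chosen so that `f^(k)` is `1/(z - w)` up to an entire function: an antiderivative
of it for `k ≥ 0`, a derivative for `k < 0`. -/
theorem nonempty_unboundedAt_of_ne_univ (hΩ : IsOpen Ω) (hsc : IsSimplyConnected Ω)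
    (hζ₀ : ζ₀ ∈ Ω) (hne : Ω ≠ univ) (k : ℤ) : (unboundedAt Ω ζ₀ k).Nonempty := by
  obtain ⟨w, hw⟩ : (frontier Ω).Nonempty := nonempty_frontier_iff.2 ⟨⟨ζ₀, hζ₀⟩, hne⟩
  rw [hΩ.frontier_eq] at hw
  let h : ℂ → ℂ := fun z => (z - w)⁻¹
  have hh : DifferentiableOn ℂ h Ω := fun z hz =>
    ((differentiableAt_id.sub_const w).inv
      (sub_ne_zero.2 fun hzw => hw.2 (hzw ▸ hz))).differentiableWithinAt
  cases k with
  | ofNat n =>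
    obtain ⟨f, hf⟩ := exists_hol_eqOn (differentiableOn_iterAntideriv hΩ hsc hζ₀ hh n)
    refine ⟨f, (unboundedOn_inv_sub_add hw.1 hw.2 continuousAt_const (e := 0)).congr ?_⟩
    intro z hz
    rw [add_zero]
    exact (hf.iteratedDeriv_of_isOpen hΩ n hz).trans
      (iteratedDeriv_iterAntideriv hΩ hsc hζ₀ hh n hz)
  | negSucc n =>
    obtain ⟨f, hf⟩ := exists_hol_eqOn (differentiableOn_iteratedDeriv hΩ hh (n + 1))
    obtain ⟨e, he, hfe⟩ := iterAntideriv_iteratedDeriv hΩ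
      hsc.isPathConnected.isConnected.isPreconnected hζ₀ (n + 1) hh hf
    exact ⟨f, (unboundedOn_inv_sub_add hw.1 hw.2 he.continuous.continuousAt).congr hfe⟩

theorem not_const_of_intDeriv_exp_univ (hsc : IsSimplyConnected (univ : Set ℂ)) {f : ℂ → ℂ}
    (hf : f = Complex.exp) (k : ℤ) (c : ℂ) :
    ¬ ∀ z, intDeriv univ ζ₀ f k z = c := by
  have hexp : ∀ c : ℂ, ¬ ∀ z, Complex.exp z = c := by
    intro c h
    have h0 := congrArg (fun f : ℂ → ℂ => deriv f 0) (funext h : Complex.exp = fun _ => c)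
    simp at h0
  subst hf
  have hneg : ∀ (n : ℕ) (c : ℂ), ¬ ∀ z, iterAntideriv univ ζ₀ Complex.exp n z = c := by
    intro n
    induction n with
    | zero => exact hexp
    | succ n ih =>
      intro c h
      -- A constant antiderivative would have derivative zero, making the previous one the constant
      -- `0`.
      refine ih 0 fun z => ?_
      have h1 := hasDerivAt_iterAntideriv isOpen_univ hsc (mem_univ ζ₀)
        Complex.differentiable_exp.differentiableOn n (mem_univ z)
      rw [funext h] at h1
      exact h1.unique (hasDerivAt_const z c)
  cases k with
  | ofNat n =>
    simp only [intDeriv, iteratedDeriv_eq_iterate, Complex.iter_deriv_exp]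
    exact hexp c
  | negSucc n => exact hneg (n + 1) c

/-- By Liouville, a bounded `exp^(k)` would be constant. -/
theorem nonempty_unboundedAt_univ (hsc : IsSimplyConnected (univ : Set ℂ)) (k : ℤ) :
    (unboundedAt univ ζ₀ k).Nonempty := by
  obtain ⟨f, hf⟩ := exists_hol_eqOn (Ω := univ) Complex.differentiable_exp.differentiableOn
  refine ⟨f, ?_⟩
  rintro ⟨M, hM⟩
  have hd := differentiableOn_univ.1 (differentiableOn_intDeriv isOpen_univ hsc (mem_univ ζ₀)
    f.2 k)
  have hb : Bornology.IsBounded (range (intDeriv univ ζ₀ (extendZero univ f.1) k)) :=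
    isBounded_iff_forall_norm_le.2 ⟨M, by rintro _ ⟨z, rfl⟩; exact hM z (mem_univ z)⟩
  exact not_const_of_intDeriv_exp_univ hsc (funext fun z => hf (mem_univ z)) k _
    fun z => hd.apply_eq_apply_of_bounded hb z 0

end

/-! ### Baire category conclusion -/

theorem mainTheorem1 (Ω : Set ℂ) (hΩ : IsOpen Ω) (hsc : IsSimplyConnected Ω)
    (ζ₀ : ℂ) (hζ₀ : ζ₀ ∈ Ω) :
    (∀ z ∈ Ω, ∃ γ : Path ζ₀ z, IsPolygonalIn Ω γ) ∧
    (∀ f : Hol Ω, ∀ k : ℕ, ∀ z ∈ Ω,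
      (∀ γ : Path ζ₀ z, IsPolygonalIn Ω γ →
        iterAntideriv Ω ζ₀ (extendZero Ω f.1) (k + 1) z =
          lineIntegral (iterAntideriv Ω ζ₀ (extendZero Ω f.1) k) γ) ∧
      HasDerivAt (iterAntideriv Ω ζ₀ (extendZero Ω f.1) (k + 1))
        (iterAntideriv Ω ζ₀ (extendZero Ω f.1) k z) z) ∧
    IsGδ (unboundedSet Ω ζ₀) ∧ Dense (unboundedSet Ω ζ₀) := by
  have := baireSpace_hol hΩ
  have hset : unboundedSet Ω ζ₀ = ⋂ k, unboundedAt Ω ζ₀ k := by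
    ext f
    simp [unboundedSet, unboundedAt]
  have hne : ∀ k, (unboundedAt Ω ζ₀ k).Nonempty := fun k => by
    by_cases hu : Ω = univ
    · subst hu
      exact nonempty_unboundedAt_univ hsc k
    · exact nonempty_unboundedAt_of_ne_univ hΩ hsc hζ₀ hu k
  refine ⟨fun z hz => exists_isPolygonalIn hΩ hsc.isPathConnected.isConnected.isPreconnected hζ₀ hz,
    fun f k z hz => ⟨fun γ hγ => iterAntideriv_succ_eq_lineIntegral hΩ hsc hζ₀ f.2 k hγ,
      hasDerivAt_iterAntideriv hΩ hsc hζ₀ f.2 k hz⟩, ?_, ?_⟩ <;> rw [hset]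
  · exact .iInter fun k => isGδ_unboundedAt hΩ hsc hζ₀ k
  · exact dense_iInter_of_Gδ (fun k => isGδ_unboundedAt hΩ hsc hζ₀ k)
      fun k => dense_unboundedAt_of_nonempty hΩ hsc hζ₀ k (hne k)
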